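/- For a negative discriminant $D$, let $C(D)$ be the class group of primitive positive definite integral binary quadratic forms of discriminant $D$ modulo $\mathrm{SL}_2(\mathbb{Z})$, with Dirichlet composition, and for a positive integer $m$ let $e\in C(-4m)$ denote the identity element, the class of $x^2+my^2$. For a positive integer $s$, a class $F\in C(Ds^2)$ is said to be derived from a class $G\in C(D)$ if there are forms $f$ in $F$ and $g$ in $G$ and an integer $2\times 2$ matrix $A$ with $\det A=s$ such that $f(x,y)=g(A\cdot(x,y)^T)$. For a positive integer $r=\prod_i p_i^{e_i}$ put $\varphi_D(r)=\prod_i p_i^{e_i-1}\left(p_i-\left(\frac{D}{p_i}\right)\right)$, where $\left(\frac{D}{p}\right)$ is the Kronecker symbol. Let $a,b$ be positive integers, $n=a^2b$, and let $g\in C(-4n)$ be derived from $e\in C(-4b)$. Let $r$ be a positive integer with $\gcd(r,a)=1$, and let $h\in C(-4nr^2)$ be any lift of $g$, that is, any class derived from $g$. Then $l=h^{\varphi_{-4n}(r)}\in C(-4nr^2)$ is derived both from $e\in C(-4b)$ and from $e\in C(-4br^2)$. -/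

import Mathlib

/-- The integral binary quadratic form `a x² + b x y + c y²`. -/
@[ext]
structure BQF where
  a : ℤ
  b : ℤ
  c : ℤ

namespace BQF

/-- The value `f(x, y)`. -/
def eval (f : BQF) (x y : ℤ) : ℤ := f.a * x ^ 2 + f.b * x * y + f.c * y ^ 2

/-- The discriminant `b² - 4ac`. -/
def disc (f : BQF) : ℤ := f.b ^ 2 - 4 * f.a * f.c

/-- `f` is primitive: `gcd(a, b, c) = 1`. -/
def Primitive (f : BQF) : Prop := Int.gcd f.a (Int.gcd f.b f.c) = 1

/-- `f` is positive definite. -/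
def PosDef (f : BQF) : Prop := ∀ x y : ℤ, (x ≠ 0 ∨ y ≠ 0) → 0 < f.eval x y

/-- The form `(x, y) ↦ f (A (x, y)ᵀ)`, for a `2 × 2` integer matrix `A`. -/
def transform (f : BQF) (A : Matrix (Fin 2) (Fin 2) ℤ) : BQF where
  a := f.eval (A 0 0) (A 1 0)
  b := 2 * f.a * A 0 0 * A 0 1 + f.b * (A 0 0 * A 1 1 + A 0 1 * A 1 0) + 2 * f.c * A 1 0 * A 1 1
  c := f.eval (A 0 1) (A 1 1)

theorem eval_transform (f : BQF) (A : Matrix (Fin 2) (Fin 2) ℤ) (x y : ℤ) :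
    (f.transform A).eval x y = f.eval (A 0 0 * x + A 0 1 * y) (A 1 0 * x + A 1 1 * y) := by
  simp only [transform, eval]; ring

theorem transform_one (f : BQF) : f.transform 1 = f := by
  ext <;> simp [transform, eval]

theorem transform_mul (f : BQF) (A B : Matrix (Fin 2) (Fin 2) ℤ) :
    f.transform (A * B) = (f.transform A).transform B := by
  ext <;> simp only [transform, eval, Matrix.mul_apply, Fin.sum_univ_two] <;> ring

theorem disc_transform (f : BQF) (A : Matrix (Fin 2) (Fin 2) ℤ) :
    (f.transform A).disc = f.disc * A.det ^ 2 := by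
  simp only [transform, eval, disc, Matrix.det_fin_two]; ring

theorem primitive_iff (f : BQF) :
    f.Primitive ↔ ∀ p : ℕ, p.Prime → ¬ ((p : ℤ) ∣ f.a ∧ (p : ℤ) ∣ f.b ∧ (p : ℤ) ∣ f.c) := by
  unfold Primitive
  rw [Nat.eq_one_iff_not_exists_prime_dvd]
  refine forall_congr' fun p => forall_congr' fun _ => not_congr ?_
  rw [← Int.natCast_dvd_natCast, Int.dvd_coe_gcd_iff, Int.dvd_coe_gcd_iff]

theorem Primitive.transform {f : BQF} (hf : f.Primitive) (A : Matrix.SpecialLinearGroup (Fin 2) ℤ) :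
    (f.transform A.1).Primitive := by
  rw [primitive_iff] at hf ⊢
  rintro p hp ⟨h1, h2, h3⟩
  apply hf p hp
  have key : f = (f.transform A.1).transform (A⁻¹).1 := by
    rw [← transform_mul, ← Matrix.SpecialLinearGroup.coe_mul, mul_inv_cancel]
    exact (transform_one f).symm
  rw [key]
  generalize f.transform A.1 = g at h1 h2 h3
  obtain ⟨s, hs⟩ := h1
  obtain ⟨t, ht⟩ := h2
  obtain ⟨u, hu⟩ := h3
  simp only [BQF.transform, eval, hs, ht, hu]
  generalize (A⁻¹).1 = M
  refine ⟨⟨s * M 0 0 ^ 2 + t * M 0 0 * M 1 0 + u * M 1 0 ^ 2, by ring⟩,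
    ⟨2 * s * M 0 0 * M 0 1 + t * (M 0 0 * M 1 1 + M 0 1 * M 1 0) + 2 * u * M 1 0 * M 1 1, by ring⟩,
    ⟨s * M 0 1 ^ 2 + t * M 0 1 * M 1 1 + u * M 1 1 ^ 2, by ring⟩⟩

theorem PosDef.transform {f : BQF} (hf : f.PosDef) (A : Matrix.SpecialLinearGroup (Fin 2) ℤ) :
    (f.transform A.1).PosDef := by
  intro x y hxy
  rw [eval_transform]
  apply hf
  by_contra! h
  obtain ⟨h1, h2⟩ := h
  have hd := A.2
  rw [Matrix.det_fin_two] at hd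
  have hx : x = 0 := by linear_combination -x * hd + A.1 1 1 * h1 - A.1 0 1 * h2
  have hy : y = 0 := by linear_combination -y * hd - A.1 1 0 * h1 + A.1 0 0 * h2
  rcases hxy with h | h
  · exact h hx
  · exact h hy

theorem PosDef.a_pos {f : BQF} (hf : f.PosDef) : 0 < f.a := by
  have := hf 1 0 (by simp)
  simpa [eval] using this

theorem PosDef.disc_neg {f : BQF} (hf : f.PosDef) : f.disc < 0 := by
  have ha := hf.a_pos
  have h := hf (-f.b) (2 * f.a) (Or.inr (by omega))
  have e : f.eval (-f.b) (2 * f.a) = f.a * -f.disc := by simp only [eval, disc]; ring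
  rw [e] at h
  have := pos_of_mul_pos_right h ha.le
  linarith

theorem posDef_of {f : BQF} (ha : 0 < f.a) (hd : f.disc < 0) : f.PosDef := by
  intro x y hxy
  have e : 4 * f.a * f.eval x y = (2 * f.a * x + f.b * y) ^ 2 + (-f.disc) * y ^ 2 := by
    simp only [eval, disc]; ring
  have hpos : 0 < 4 * f.a * f.eval x y := by
    rw [e]
    have ha0 : f.a ≠ 0 := ha.ne'
    by_cases hy : y = 0
    · subst hy
      have hx : x ≠ 0 := by simpa using hxy
      have : 2 * f.a * x + f.b * 0 ≠ 0 := by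
        simp [hx, ha0]
      have h2 := sq_pos_of_ne_zero this
      simpa using h2
    · have : 0 < -f.disc := by linarith
      positivity
  exact pos_of_mul_pos_right hpos (by positivity)

end BQF

/-- The primitive positive definite binary quadratic forms of discriminant `D`. -/
abbrev PForm (D : ℤ) : Type := {f : BQF // f.disc = D ∧ f.Primitive ∧ f.PosDef}

namespace PForm

/-- `f ∼ g` if `f(x, y) = g(A (x, y)ᵀ)` for some `A ∈ SL₂(ℤ)`. -/
instance setoid (D : ℤ) : Setoid (PForm D) where
  r f g := ∃ A : Matrix.SpecialLinearGroup (Fin 2) ℤ, f.1 = g.1.transform A.1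
  iseqv :=
    { refl := fun f => ⟨1, (BQF.transform_one f.1).symm⟩
      symm := by
        rintro f g ⟨A, hA⟩
        refine ⟨A⁻¹, ?_⟩
        rw [hA, ← BQF.transform_mul, ← Matrix.SpecialLinearGroup.coe_mul, mul_inv_cancel]
        exact (BQF.transform_one g.1).symm
      trans := by
        rintro f g k ⟨A, hA⟩ ⟨B, hB⟩
        refine ⟨B * A, ?_⟩
        rw [hA, hB, ← BQF.transform_mul, ← Matrix.SpecialLinearGroup.coe_mul] }

/-- `k` is a Dirichlet composition of `f` and `g`: one has `gcd(a₁, a₂, (b₁ + b₂)/2) = 1` and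
`k = (a₁a₂, B, (B² - D)/(4a₁a₂))`, where `B ≡ b₁ mod 2a₁`, `B ≡ b₂ mod 2a₂`
and `B² ≡ D mod 4a₁a₂`. (The last congruence, and the value of the third coefficient of `k`, are
expressed by `k` having discriminant `D`; the sum `b₁ + b₂` is even as `b₁ ≡ D ≡ b₂ mod 2`.) -/
def IsDirichletComposition {D : ℤ} (f g k : PForm D) : Prop :=
  Int.gcd f.1.a (Int.gcd g.1.a ((f.1.b + g.1.b) / 2)) = 1 ∧
    k.1.a = f.1.a * g.1.a ∧
    k.1.b ≡ f.1.b [ZMOD 2 * f.1.a] ∧ k.1.b ≡ g.1.b [ZMOD 2 * g.1.a]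

end PForm

/-- A primitive form properly represents an integer coprime to any given `M ≠ 0`. -/
theorem BQF.Primitive.exists_coprime {f : BQF} (hf : f.Primitive) (M : ℤ) (hM : M ≠ 0) :
    ∃ x y : ℤ, IsCoprime x y ∧ IsCoprime (f.eval x y) M := by
  classical
  rw [BQF.primitive_iff] at hf
  set S := M.natAbs.primeFactors with hS
  set X := S.filter (fun p : ℕ => (p : ℤ) ∣ f.a ∧ ¬ (p : ℤ) ∣ f.c) with hX
  set Y := S.filter (fun p : ℕ => ¬ (p : ℤ) ∣ f.a) with hY
  have hprime : ∀ p ∈ S, p.Prime := fun p hp => Nat.prime_of_mem_primeFactors hp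
  have hdvd : ∀ T ⊆ S, ∀ p : ℕ, p.Prime → ((p : ℤ) ∣ ((∏ q ∈ T, q : ℕ) : ℤ) ↔ p ∈ T) := by
    intro T hT p hp
    rw [Int.natCast_dvd_natCast, Prime.dvd_finsetProd_iff hp.prime]
    constructor
    · rintro ⟨q, hq, hpq⟩
      rwa [(Nat.prime_dvd_prime_iff_eq hp (hprime q (hT hq))).1 hpq]
    · intro h
      exact ⟨p, h, dvd_rfl⟩
  have hXS : X ⊆ S := Finset.filter_subset _ _
  have hYS : Y ⊆ S := Finset.filter_subset _ _
  refine ⟨((∏ q ∈ X, q : ℕ) : ℤ), ((∏ q ∈ Y, q : ℕ) : ℤ), ?_, ?_⟩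
  · rw [Nat.isCoprime_iff_coprime]
    refine Nat.coprime_of_dvd fun p hp h1 h2 => ?_
    have h1' := (hdvd X hXS p hp).1 (Int.natCast_dvd_natCast.2 h1)
    have h2' := (hdvd Y hYS p hp).1 (Int.natCast_dvd_natCast.2 h2)
    rw [hX, Finset.mem_filter] at h1'
    rw [hY, Finset.mem_filter] at h2'
    exact h2'.2 h1'.2.1
  · rw [Int.isCoprime_iff_gcd_eq_one, Nat.eq_one_iff_not_exists_prime_dvd]
    intro p hp h
    have hpi : Prime (p : ℤ) := Nat.prime_iff_prime_int.1 hp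
    rw [← Int.natCast_dvd_natCast, Int.dvd_coe_gcd_iff] at h
    obtain ⟨h1, h2⟩ := h
    have hpS : p ∈ S := Nat.mem_primeFactors.2
      ⟨hp, Int.natCast_dvd.1 h2, Int.natAbs_ne_zero.2 hM⟩
    have hx := hdvd X hXS p hp
    have hy := hdvd Y hYS p hp
    generalize ((∏ q ∈ X, q : ℕ) : ℤ) = x at h1 hx
    generalize ((∏ q ∈ Y, q : ℕ) : ℤ) = y at h1 hy
    rw [hX, Finset.mem_filter] at hx
    rw [hY, Finset.mem_filter] at hy
    have hp2 : ∀ z : ℤ, (p : ℤ) ∣ z ^ 2 → (p : ℤ) ∣ z := fun z => hpi.dvd_of_dvd_pow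
    unfold BQF.eval at h1
    by_cases ha : (p : ℤ) ∣ f.a
    · have hy' : ¬ (p : ℤ) ∣ y := fun h => (hy.1 h).2 ha
      by_cases hc : (p : ℤ) ∣ f.c
      · have hx' : ¬ (p : ℤ) ∣ x := fun h => (hx.1 h).2.2 hc
        have h3 : (p : ℤ) ∣ f.b * x * y := by
          have := dvd_sub h1 (dvd_add (ha.mul_right (x ^ 2)) (hc.mul_right (y ^ 2)))
          ring_nf at this ⊢
          exact this
        rcases hpi.dvd_or_dvd h3 with h3 | h3
        · rcases hpi.dvd_or_dvd h3 with h3 | h3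
          · exact hf p hp ⟨ha, h3, hc⟩
          · exact hx' h3
        · exact hy' h3
      · have hx' : (p : ℤ) ∣ x := hx.2 ⟨hpS, ha, hc⟩
        have h3 : (p : ℤ) ∣ f.c * y ^ 2 := by
          have := dvd_sub h1 (dvd_add (ha.mul_right (x ^ 2)) (hx'.mul_left (f.b * y)))
          ring_nf at this ⊢
          exact this
        rcases hpi.dvd_or_dvd h3 with h3 | h3
        · exact hc h3
        · exact hy' (hp2 y h3)
    · have hy' : (p : ℤ) ∣ y := hy.2 ⟨hpS, ha⟩
      have hx' : ¬ (p : ℤ) ∣ x := fun h => ha (hx.1 h).2.1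
      have h3 : (p : ℤ) ∣ f.a * x ^ 2 := by
        have := dvd_sub h1 (hy'.mul_left (f.b * x + f.c * y))
        ring_nf at this ⊢
        exact this
      rcases hpi.dvd_or_dvd h3 with h3 | h3
      · exact ha h3
      · exact hx' (hp2 x h3)

/-- Up to equivalence, any two forms of the same discriminant have a Dirichlet composition. -/
theorem PForm.exists_composition {D : ℤ} (f g : PForm D) :
    ∃ g' k : PForm D, g' ≈ g ∧ IsDirichletComposition f g' k := by
  have ha1 := f.2.2.2.a_pos
  obtain ⟨x, y, hxy, hcop⟩ := g.2.2.1.exists_coprime f.1.a ha1.ne'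
  obtain ⟨u, v, huv⟩ := hxy
  let A : Matrix.SpecialLinearGroup (Fin 2) ℤ :=
    ⟨!![x, -v; y, u], by rw [Matrix.det_fin_two_of]; linear_combination huv⟩
  let g' : PForm D := ⟨g.1.transform A.1, by
      rw [BQF.disc_transform, A.2, g.2.1]; ring, g.2.2.1.transform A, g.2.2.2.transform A⟩
  have hg'a : g'.1.a = g.1.eval x y := rfl
  have ha2 := g'.2.2.2.a_pos
  rw [← hg'a] at hcop
  have hgg : g' ≈ g := ⟨A, rfl⟩
  clear_value g'
  have hD1 : f.1.b ^ 2 - 4 * f.1.a * f.1.c = D := f.2.1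
  have hD2 : g'.1.b ^ 2 - 4 * g'.1.a * g'.1.c = D := g'.2.1
  have hDneg : D < 0 := f.2.1 ▸ f.2.2.2.disc_neg
  have hpr1 := (BQF.primitive_iff _).1 f.2.2.1
  have hpr2 := (BQF.primitive_iff _).1 g'.2.2.1
  obtain ⟨s, hs⟩ : (2 : ℤ) ∣ g'.1.b - f.1.b := by
    have h : Even ((g'.1.b - f.1.b) ^ 2) := by
      refine ⟨f.1.b ^ 2 - g'.1.b * f.1.b + 2 * (g'.1.a * g'.1.c - f.1.a * f.1.c), ?_⟩
      linear_combination hD2 - hD1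
    exact (Int.even_pow.1 h).1.two_dvd
  obtain ⟨i, j, hij⟩ := hcop
  set B := f.1.b + 2 * f.1.a * (j * s) with hB
  have hB2 : B = g'.1.b - 2 * g'.1.a * (i * s) := by
    rw [hB]; linear_combination 2 * s * hij - hs
  have hdiv : g'.1.a * f.1.a ∣ f.1.a * (f.1.c + f.1.b * (j * s) + f.1.a * (j * s) ^ 2) := by
    apply IsCoprime.mul_dvd ⟨i, j, hij⟩
    · refine ⟨g'.1.c - g'.1.b * (i * s) + g'.1.a * (i * s) ^ 2, ?_⟩
      have h4 : (4 : ℤ) * (f.1.a * (f.1.c + f.1.b * (j * s) + f.1.a * (j * s) ^ 2)) =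
          4 * (g'.1.a * (g'.1.c - g'.1.b * (i * s) + g'.1.a * (i * s) ^ 2)) := by
        have : B ^ 2 = (g'.1.b - 2 * g'.1.a * (i * s)) ^ 2 := by rw [hB2]
        rw [hB] at this
        linear_combination this - hD1 + hD2
      linarith
    · exact dvd_mul_right _ _
  obtain ⟨C, hC⟩ := hdiv
  have hkd : (BQF.mk (f.1.a * g'.1.a) B C).disc = D := by
    simp only [BQF.disc]
    rw [hB]; linear_combination hD1 + 4 * hC
  have hkpd : (BQF.mk (f.1.a * g'.1.a) B C).PosDef :=
    BQF.posDef_of (mul_pos ha1 ha2) (by rw [hkd]; exact hDneg)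
  have hkpr : (BQF.mk (f.1.a * g'.1.a) B C).Primitive := by
    rw [BQF.primitive_iff]
    rintro p hp ⟨h1, h2, h3⟩
    simp only at h1 h2 h3
    have hpi : Prime (p : ℤ) := Nat.prime_iff_prime_int.1 hp
    rcases hpi.dvd_or_dvd h1 with h | h
    · refine hpr1 p hp ⟨h, ?_, ?_⟩
      · have := dvd_sub h2 (h.mul_right (2 * (j * s)))
        have e : f.1.b = B - f.1.a * (2 * (j * s)) := by rw [hB]; ring
        rw [e]; exact this
      · have hc : f.1.c = g'.1.a * C - B * (j * s) + f.1.a * (j * s) ^ 2 := by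
          have : f.1.a * f.1.c = f.1.a * (g'.1.a * C - B * (j * s) + f.1.a * (j * s) ^ 2) := by
            rw [hB]; linear_combination hC
          exact mul_left_cancel₀ ha1.ne' this
        rw [hc]
        exact dvd_add (dvd_sub (h3.mul_left _) (h2.mul_right _)) (h.mul_right _)
    · refine hpr2 p hp ⟨h, ?_, ?_⟩
      · have : g'.1.b = B + g'.1.a * (2 * (i * s)) := by rw [hB2]; ring
        rw [this]; exact dvd_add h2 (h.mul_right _)
      · have hc : g'.1.c = f.1.a * C + B * (i * s) + g'.1.a * (i * s) ^ 2 := by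
          have : (4 * g'.1.a) * g'.1.c =
              (4 * g'.1.a) * (f.1.a * C + B * (i * s) + g'.1.a * (i * s) ^ 2) := by
            have hkd' : B ^ 2 - 4 * (f.1.a * g'.1.a) * C = D := hkd
            have hb : g'.1.b = B + g'.1.a * (2 * (i * s)) := by rw [hB2]; ring
            rw [hb] at hD2
            linear_combination hkd' - hD2
          exact mul_left_cancel₀ (by positivity) this
        rw [hc]
        exact dvd_add (dvd_add (h3.mul_left _) (h2.mul_right _)) (h.mul_right _)
  refine ⟨g', ⟨⟨f.1.a * g'.1.a, B, C⟩, hkd, hkpr, hkpd⟩, hgg, ?_, rfl, ?_, ?_⟩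
  · have h1 : Int.gcd f.1.a g'.1.a = 1 := Int.isCoprime_iff_gcd_eq_one.1 ⟨j, i, by
      linear_combination hij⟩
    have h2 : Int.gcd f.1.a (Int.gcd g'.1.a ((f.1.b + g'.1.b) / 2)) ∣ Int.gcd f.1.a g'.1.a :=
      Int.dvd_gcd (Int.gcd_dvd_left _ _) ((Int.gcd_dvd_right _ _).trans (Int.gcd_dvd_left _ _))
    rw [h1] at h2
    exact Nat.dvd_one.1 h2
  · exact (Int.modEq_iff_dvd.2 ⟨j * s, by simp only [hB]; ring⟩ : f.1.b ≡ B [ZMOD _]).symm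
  · exact Int.modEq_iff_dvd.2 ⟨i * s, by linear_combination -hB2⟩

/-- The underlying set of the class group `C(D)`, for a negative discriminant `D`: the
`SL₂(ℤ)`-equivalence classes of primitive positive definite forms of discriminant `D`. -/
def FormClass (D : ℤ) : Type := Quotient (PForm.setoid D)

namespace FormClass

/-- The class of a form. -/
def mk {D : ℤ} (f : PForm D) : FormClass D := Quotient.mk _ f

/-- `K` contains a Dirichlet composition of a form in `F` and a form in `G`. -/
def IsComposition {D : ℤ} (F G K : FormClass D) : Prop :=
  ∃ f g k : PForm D, mk f = F ∧ mk g = G ∧ mk k = K ∧ PForm.IsDirichletComposition f g k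

theorem exists_isComposition {D : ℤ} (F G : FormClass D) : ∃ K, IsComposition F G K := by
  induction F using Quotient.inductionOn with | _ f => ?_
  induction G using Quotient.inductionOn with | _ g => ?_
  obtain ⟨g', k, hg, hk⟩ := f.exists_composition g
  exact ⟨mk k, f, g', k, rfl, Quotient.sound hg, rfl, hk⟩

/-- The group operation of `C(D)`: composition of classes, that is, the class of the Dirichlet
composition of representatives. -/
noncomputable instance (D : ℤ) : Mul (FormClass D) :=
  ⟨fun F G => (exists_isComposition F G).choose⟩

theorem mul_isComposition {D : ℤ} (F G : FormClass D) : IsComposition F G (F * G) :=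
  (exists_isComposition F G).choose_spec

/-- The identity element `e = (1, 0, m)` of `C(-4m)`. -/
def e (m : ℕ+) : FormClass (-4 * (m : ℤ)) :=
  mk ⟨⟨1, 0, m⟩, by simp [BQF.disc], by simp [BQF.Primitive],
    BQF.posDef_of (by simp) (by simp [BQF.disc])⟩

/-- Powers in the class group `C(-4m)`: `F ^ 0 = e` and `F ^ (k + 1) = F ^ k * F`. -/
noncomputable def pow {m : ℕ+} (F : FormClass (-4 * (m : ℤ))) : ℕ → FormClass (-4 * (m : ℤ))
  | 0 => e m
  | k + 1 => pow F k * F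

/-- `F ∈ C(D')` is derived from `G ∈ C(D)` by a transformation of determinant `r`: there are forms
`f` in `F` and `g` in `G` and an integer matrix `A` of determinant `r` such that
`f(x, y) = g(A (x, y)ᵀ)`. (This forces `D' = D r²`.) -/
def IsDerived {D' D : ℤ} (r : ℤ) (F : FormClass D') (G : FormClass D) : Prop :=
  ∃ (f : PForm D') (g : PForm D) (A : Matrix (Fin 2) (Fin 2) ℤ),
    mk f = F ∧ mk g = G ∧ A.det = r ∧ f.1 = g.1.transform A

end FormClass

/-- The Kronecker symbol `(D / p)` for a prime number `p`. For `p = 2` it is `0` if `D` is even,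
`1` if `D ≡ ±1 mod 8` and `-1` if `D ≡ ±3 mod 8`; for odd `p` it is the Legendre symbol. -/
def kroneckerPrime (D : ℤ) (p : ℕ) : ℤ :=
  if p = 2 then ZMod.χ₈ (D : ZMod 8) else jacobiSym D p

/-- `φ_D(r) = ∏ pᵢ ^ (eᵢ - 1) (pᵢ - (D / pᵢ))` for `r = ∏ pᵢ ^ eᵢ`. (All factors are positive.) -/
def phi (D : ℤ) (r : ℕ) : ℕ :=
  ∏ p ∈ r.primeFactors, p ^ (r.factorization p - 1) * ((p : ℤ) - kroneckerPrime D p).toNat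

/-! Work in `ℤ√(-b)`. A class derived from `e ∈ C(-4b)` by determinant `N` is the class of the norm
form of an oriented lattice of index `N` (`FormClass.isDerived_e_iff`), so `h` comes from a lattice
of index `ar`. Since `r` divides this index, a lattice vector `α` of norm prime to `r` forces the
whole lattice into `ℤα + rℤ√(-b)` (`IsNormFormMod.of_isCoprime`). Dirichlet composition multiplies
lattices, keeps the index and multiplies the residues `α` (`IsNormFormMod.composition`), so `h ^ k`
has a lattice of index `ar` inside `ℤα^k + rℤ√(-b)`.

For `k = φ(r)` the power `α ^ k` is an integer modulo `r` (`dvd_im_pow_phi`), by Frobenius at each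
odd prime and a direct computation at `2`. The lattice then lies in `ℤ + rℤ√(-b)`, a copy of
`ℤ√(-br²)`, where its index is `a`. The two orders give the two derivations. -/

namespace Zsqrtd

/-! ### Norm forms of lattices and their composition. -/

variable {d : ℤ}

/-- The norm form `(x, y) ↦ N(x α + y β)` on the lattice spanned by `α` and `β`. -/
def normForm (α β : ℤ√d) : BQF := ⟨α.norm, 2 * (star α * β).re, β.norm⟩

/-- The elements of `ℤ√d` congruent to an integer multiple of `ξ` modulo `r`. -/
def multiplesMod (r : ℤ) (ξ : ℤ√d) : AddSubgroup (ℤ√d) where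
  carrier := {z | ∃ (t : ℤ) (η : ℤ√d), z = t * ξ + r * η}
  zero_mem' := ⟨0, 0, by simp⟩
  add_mem' := by
    rintro _ _ ⟨s, η, rfl⟩ ⟨t, θ, rfl⟩
    exact ⟨s + t, η + θ, by push_cast; ring⟩
  neg_mem' := by
    rintro _ ⟨s, η, rfl⟩
    exact ⟨-s, -η, by push_cast; ring⟩

theorem intCast_mul_mem_multiplesMod {r : ℤ} {ξ z : ℤ√d} (t : ℤ) (hz : z ∈ multiplesMod r ξ) :
    (t : ℤ√d) * z ∈ multiplesMod r ξ := by
  rw [← zsmul_eq_mul]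
  exact zsmul_mem hz t

theorem mul_mem_multiplesMod {r : ℤ} {ξ ζ z w : ℤ√d} (hz : z ∈ multiplesMod r ξ)
    (hw : w ∈ multiplesMod r ζ) : z * w ∈ multiplesMod r (ξ * ζ) := by
  obtain ⟨s, η, rfl⟩ := hz
  obtain ⟨t, θ, rfl⟩ := hw
  exact ⟨s * t, s * ξ * θ + t * ζ * η + r * η * θ, by push_cast; ring⟩

/-- An element of `multiplesMod r ξ` has imaginary part divisible by `r` if `ξ` does. -/
theorem dvd_im_of_mem_multiplesMod {r : ℤ} {ξ z : ℤ√d} (hξ : r ∣ ξ.im)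
    (hz : z ∈ multiplesMod r ξ) : r ∣ z.im := by
  obtain ⟨t, η, rfl⟩ := hz
  have : ((t : ℤ√d) * ξ + r * η).im = t * ξ.im + r * η.im := by simp
  rw [this]
  exact dvd_add (hξ.mul_left t) (dvd_mul_right _ _)

theorem star_mul_self_eq_norm (α : ℤ√d) : star α * α = (α.norm : ℤ√d) := by
  rw [norm_eq_mul_conj, mul_comm]

theorem re_star_mul (α β : ℤ√d) : (star α * β).re = α.re * β.re - d * α.im * β.im := by
  simp; ring

theorem im_star_mul (α β : ℤ√d) : (star α * β).im = α.re * β.im - α.im * β.re := by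
  simp; ring

/-- `f` is the norm form of an oriented lattice of index `N` contained in `ℤ ξ + r ℤ√d`. -/
def IsNormFormMod (d N r : ℤ) (ξ : ℤ√d) (f : BQF) : Prop :=
  ∃ α ∈ multiplesMod r ξ, ∃ β ∈ multiplesMod r ξ, (star α * β).im = N ∧ f = normForm α β

theorem normForm_transform (α β : ℤ√d) (A : Matrix (Fin 2) (Fin 2) ℤ) :
    (normForm α β).transform A =
      normForm ((A 0 0 : ℤ√d) * α + (A 1 0 : ℤ√d) * β) ((A 0 1 : ℤ√d) * α + (A 1 1 : ℤ√d) * β) := by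
  ext <;> simp [normForm, BQF.transform, BQF.eval, norm_def] <;> ring

/-- `(star α * β).im` is the determinant of `(α, β)` in the basis `1, √d`, hence the oriented index
of the lattice. -/
theorem im_star_mul_transform (α β : ℤ√d) (A : Matrix (Fin 2) (Fin 2) ℤ) :
    (star ((A 0 0 : ℤ√d) * α + (A 1 0 : ℤ√d) * β) *
      ((A 0 1 : ℤ√d) * α + (A 1 1 : ℤ√d) * β)).im =
      (star α * β).im * A.det := by
  simp [Matrix.det_fin_two]; ring

theorem IsNormFormMod.transform {N r : ℤ} {ξ : ℤ√d} {f : BQF} (hf : IsNormFormMod d N r ξ f)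
    (A : Matrix.SpecialLinearGroup (Fin 2) ℤ) : IsNormFormMod d N r ξ (f.transform A.1) := by
  obtain ⟨α, hα, β, hβ, hN, rfl⟩ := hf
  refine ⟨_, add_mem (intCast_mul_mem_multiplesMod _ hα) (intCast_mul_mem_multiplesMod _ hβ),
    _, add_mem (intCast_mul_mem_multiplesMod _ hα) (intCast_mul_mem_multiplesMod _ hβ),
    ?_, normForm_transform α β A.1⟩
  rw [im_star_mul_transform, A.2, hN, mul_one]

/-- The product of two lattices has the Dirichlet composition as norm form. -/
theorem IsNormFormMod.composition {D N r : ℤ} {ξ ζ : ℤ√d} {f g k : PForm D}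
    (hf : IsNormFormMod d N r ξ f.1) (hg : IsNormFormMod d N r ζ g.1)
    (hk : PForm.IsDirichletComposition f g k) : IsNormFormMod d N r (ξ * ζ) k.1 := by
  obtain ⟨α₁, hα₁, β₁, hβ₁, hN₁, hf⟩ := hf
  obtain ⟨α₂, hα₂, β₂, hβ₂, hN₂, hg⟩ := hg
  obtain ⟨hgcd, hka, hkf, hkg⟩ := hk
  have hf1 : f.1.a = α₁.norm := by rw [hf]; rfl
  have hf2 : f.1.b = 2 * (star α₁ * β₁).re := by rw [hf]; rfl
  have hg1 : g.1.a = α₂.norm := by rw [hg]; rfl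
  have hg2 : g.1.b = 2 * (star α₂ * β₂).re := by rw [hg]; rfl
  have hA := k.2.2.2.a_pos
  have hdisc : k.1.disc = f.1.disc := k.2.1.trans f.2.1.symm
  have hfdisc : f.1.disc = 4 * (d * N ^ 2) := by
    rw [← hN₁, hf]
    simp [normForm, BQF.disc, norm_def]; ring
  obtain ⟨t₁, ht₁⟩ := hkf.symm.dvd
  obtain ⟨t₂, ht₂⟩ := hkg.symm.dvd
  obtain ⟨c, hc⟩ : ∃ c, k.1.b = 2 * c :=
    ⟨(star α₁ * β₁).re + f.1.a * t₁, by linear_combination ht₁ + hf2⟩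
  have hre₁ : (star α₁ * β₁).re = c - f.1.a * t₁ := by linarith
  have hre₂ : (star α₂ * β₂).re = c - g.1.a * t₂ := by linarith
  have hhalf : (f.1.b + g.1.b) / 2 = k.1.b - f.1.a * t₁ - g.1.a * t₂ := by
    have : f.1.b + g.1.b = 2 * (k.1.b - f.1.a * t₁ - g.1.a * t₂) := by linarith
    rw [this, Int.mul_ediv_cancel_left _ two_ne_zero]
  -- Modulo `a₁` and `a₂` the half-sum `(b₁ + b₂)/2` agrees with `B = k.1.b`, so `a₁, a₂, B`
  -- generate the unit ideal.
  obtain ⟨u, v, w, huvw⟩ : ∃ u v w : ℤ, u * f.1.a + v * g.1.a + w * k.1.b = 1 := by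
    obtain ⟨x, y, hxy⟩ := Int.isCoprime_iff_gcd_eq_one.2 hgcd
    rw [Int.gcd_eq_gcd_ab g.1.a, hhalf] at hxy
    generalize Int.gcdA _ _ = p at hxy
    generalize Int.gcdB _ _ = q at hxy
    exact ⟨x - y * q * t₁, y * p - y * q * t₂, y * q, by linear_combination hxy⟩
  -- `ω = B/2 + N√d`. Adding multiples of `αᵢ` to `βᵢ` makes both `star αᵢ * γᵢ` equal to this one
  -- `ω`, a root of `X² - BX + a₁a₂C`.
  set ω : ℤ√d := ⟨c, N⟩ with hω
  have hω₁ : star α₁ * (β₁ + t₁ * α₁) = ω := by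
    have h1 : star α₁ * β₁ = ⟨c - f.1.a * t₁, N⟩ := Zsqrtd.ext hre₁ hN₁
    have h2 := star_mul_self_eq_norm α₁
    rw [← hf1] at h2
    have : star α₁ * (β₁ + t₁ * α₁) = star α₁ * β₁ + t₁ * (star α₁ * α₁) := by ring
    rw [this, h1, h2]
    ext <;> simp [hω]; ring
  have hω₂ : star α₂ * (β₂ + t₂ * α₂) = ω := by
    have h1 : star α₂ * β₂ = ⟨c - g.1.a * t₂, N⟩ := Zsqrtd.ext hre₂ hN₂
    have h2 := star_mul_self_eq_norm α₂
    rw [← hg1] at h2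
    have : star α₂ * (β₂ + t₂ * α₂) = star α₂ * β₂ + t₂ * (star α₂ * α₂) := by ring
    rw [this, h1, h2]
    ext <;> simp [hω]; ring
  have hcc : c * c - d * N * N = k.1.a * k.1.c := by
    have : k.1.b ^ 2 - 4 * k.1.a * k.1.c = 4 * (d * N ^ 2) := hdisc.trans hfdisc
    rw [hc] at this
    linarith
  have hωsq : ω * ω + k.1.c * (f.1.a * g.1.a) = k.1.b * ω := by
    rw [hka] at hcc
    ext
    · simp [hω, hc]; linear_combination -hcc
    · simp [hω, hc]; ring
  have hS₁ := add_mem hβ₁ (intCast_mul_mem_multiplesMod t₁ hα₁)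
  have hS₂ := add_mem hβ₂ (intCast_mul_mem_multiplesMod t₂ hα₂)
  generalize β₁ + t₁ * α₁ = γ₁ at hω₁ hS₁
  generalize β₂ + t₂ * α₂ = γ₂ at hω₂ hS₂
  have hn₁ := star_mul_self_eq_norm α₁
  have hn₂ := star_mul_self_eq_norm α₂
  rw [← hf1] at hn₁
  rw [← hg1] at hn₂
  obtain ⟨γ, hγ, hγω⟩ : ∃ γ ∈ multiplesMod r (ξ * ζ), star (α₁ * α₂) * γ = ω := by
    -- Times `star (α₁ * α₂)`, the three terms become `a₁ω`, `a₂ω` and `ω² + a₁a₂C = Bω`; the Bezout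
    -- relation sums them to `ω`.
    refine ⟨u * (α₁ * γ₂) + v * (γ₁ * α₂) + w * (γ₁ * γ₂ + k.1.c * (α₁ * α₂)), ?_, ?_⟩
    · exact add_mem (add_mem (intCast_mul_mem_multiplesMod _ (mul_mem_multiplesMod hα₁ hS₂))
        (intCast_mul_mem_multiplesMod _ (mul_mem_multiplesMod hS₁ hα₂)))
        (intCast_mul_mem_multiplesMod _ (add_mem (mul_mem_multiplesMod hS₁ hS₂)
          (intCast_mul_mem_multiplesMod _ (mul_mem_multiplesMod hα₁ hα₂))))
    · have h1 : ((u * f.1.a + v * g.1.a + w * k.1.b : ℤ) : ℤ√d) = 1 := by rw [huvw]; simp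
      push_cast at h1
      have e : star (α₁ * α₂) * (u * (α₁ * γ₂) + v * (γ₁ * α₂) +
          w * (γ₁ * γ₂ + k.1.c * (α₁ * α₂))) =
          u * (star α₁ * α₁) * (star α₂ * γ₂) + v * (star α₁ * γ₁) * (star α₂ * α₂) +
          w * ((star α₁ * γ₁) * (star α₂ * γ₂) + k.1.c * ((star α₁ * α₁) * (star α₂ * α₂))) := by
        rw [star_mul]; ring
      rw [e, hω₁, hω₂, hn₁, hn₂, hωsq]
      linear_combination ω * h1
  have hnorm : (α₁ * α₂).norm = k.1.a := by rw [norm_mul, hka, hf1, hg1]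
  refine ⟨α₁ * α₂, mul_mem_multiplesMod hα₁ hα₂, γ, hγ, by rw [hγω], ?_⟩
  ext
  · exact hnorm.symm
  · rw [hc]; simp only [normForm, hγω, hω]
  · have h1 := congrArg Zsqrtd.norm hγω
    rw [norm_mul, norm_conj, hnorm] at h1
    refine mul_left_cancel₀ hA.ne' (?_ : k.1.a * k.1.c = k.1.a * γ.norm)
    rw [h1, ← hcc, hω, norm_def]

/-- The norm form of a lattice of index divisible by `r`, with leading coefficient prime to `r`. -/
theorem IsNormFormMod.of_isCoprime {N r : ℤ} {α β : ℤ√d} (hN : (star α * β).im = N) (hr : r ∣ N)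
    (hα : IsCoprime α.norm r) : IsNormFormMod d N r α (normForm α β) := by
  refine ⟨α, ⟨1, 0, by simp⟩, β, ?_, hN, rfl⟩
  obtain ⟨u, v, huv⟩ := hα
  obtain ⟨q, rfl⟩ := hr
  have h1 : ((u * α.norm + v * r : ℤ) : ℤ√d) = 1 := by rw [huv]; simp
  push_cast at h1
  rw [norm_eq_mul_conj] at h1
  -- Modulo `r`, `star α * β` is an integer and `N(α)` has inverse `u`, so `β ≡ u * α * (star α *
  -- β)` is an integer multiple of `α`.
  have h2 : star α * β = (((star α * β).re : ℤ) : ℤ√d) + r * (q * (sqrtd : ℤ√d)) := by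
    ext
    · simp
    · simp only [hN]; simp
  refine ⟨u * (star α * β).re, u * α * q * (sqrtd : ℤ√d) + v * β, ?_⟩
  push_cast
  linear_combination -β * h1 + u * α * h2

/-! ### Powers that become integers modulo `r`. -/

/-- If `(d / p) = ε` then `z ^ (p - ε)` is an integer modulo the odd prime `p`. -/
theorem exists_dvd_pow_sub_intCast {p : ℕ} [hp : Fact p.Prime] (hp2 : p ≠ 2) (z : ℤ√d)
    (hz : IsCoprime z.norm (p : ℤ)) :
    ∃ x : ℤ, (p : ℤ√d) ∣ z ^ ((p : ℤ) - legendreSym p d).toNat - x := by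
  have hleg := legendreSym.eq_pow p d
  -- Frobenius with Euler's criterion: `√d ^ p = d ^ ((p - 1)/2) √d ≡ (d/p) √d`.
  have hfrob : (p : ℤ√d) ∣ z ^ p - (z.re + legendreSym p d * z.im * (sqrtd : ℤ√d)) := by
    obtain ⟨η, hη⟩ := exists_add_pow_prime_eq hp.out (z.re : ℤ√d) (z.im * (sqrtd : ℤ√d))
    have hz' : (z.re : ℤ√d) + z.im * (sqrtd : ℤ√d) = z := by ext <;> simp
    have hsq : (sqrtd : ℤ√d) * sqrtd = (d : ℤ√d) := by ext <;> simp
    have hodd : p = 2 * (p / 2) + 1 := by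
      have := hp.out.eq_two_or_odd
      omega
    have hsp : (sqrtd : ℤ√d) ^ p = (d : ℤ√d) ^ (p / 2) * sqrtd := by
      conv_lhs => rw [hodd]
      rw [pow_succ, pow_mul, sq, hsq]
    have h1 : (p : ℤ) ∣ z.re ^ p - z.re := by
      rw [← ZMod.intCast_eq_intCast_iff_dvd_sub]
      push_cast
      rw [ZMod.pow_card]
    have h2 : (p : ℤ) ∣ z.im ^ p * d ^ (p / 2) - legendreSym p d * z.im := by
      rw [← ZMod.intCast_eq_intCast_iff_dvd_sub]
      push_cast
      rw [ZMod.pow_card, hleg, mul_comm]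
    obtain ⟨s, hs⟩ := h1
    obtain ⟨t, ht⟩ := h2
    have hs' := congrArg (Int.cast : ℤ → ℤ√d) hs
    have ht' := congrArg (Int.cast : ℤ → ℤ√d) ht
    push_cast at hs' ht'
    rw [hz', mul_pow, hsp] at hη
    refine ⟨s + t * (sqrtd : ℤ√d) + z.re * (z.im * (sqrtd : ℤ√d)) * η, ?_⟩
    linear_combination hη + hs' + sqrtd * ht'
  have hpp := hp.out.one_lt
  by_cases h0 : (d : ZMod p) = 0
  · rw [(legendreSym.eq_zero_iff p d).2 h0] at hfrob ⊢
    exact ⟨z.re, by simpa using hfrob⟩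
  rcases legendreSym.eq_one_or_neg_one p h0 with h | h <;> rw [h] at hfrob ⊢
  -- Here `z ^ p ≡ z`, and `z` is invertible modulo `p` because its norm is.
  · refine ⟨1, ?_⟩
    have e : ((p : ℤ) - 1).toNat = p - 1 := by omega
    have hz' : (z.re : ℤ√d) + (1 : ℤ) * z.im * (sqrtd : ℤ√d) = z := by ext <;> simp
    rw [hz'] at hfrob
    rw [e]
    obtain ⟨u, v, huv⟩ := hz
    have h1 : ((u * z.norm + v * p : ℤ) : ℤ√d) = 1 := by rw [huv]; simp
    push_cast at h1
    rw [norm_eq_mul_conj] at h1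
    obtain ⟨η, hη⟩ := hfrob
    have hzp : z ^ p = z ^ (p - 1) * z := by rw [← pow_succ]; congr 1; omega
    rw [hzp] at hη
    refine ⟨u * star z * η + v * (z ^ (p - 1) - 1), ?_⟩
    push_cast
    linear_combination (1 - z ^ (p - 1)) * h1 + u * star z * hη
  -- Here `z ^ p ≡ star z`, so `z ^ (p + 1)` is congruent to the norm.
  · refine ⟨z.norm, ?_⟩
    have e : ((p : ℤ) - -1).toNat = p + 1 := by omega
    have hz' : (z.re : ℤ√d) + (-1 : ℤ) * z.im * (sqrtd : ℤ√d) = star z := by ext <;> simp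
    rw [hz'] at hfrob
    rw [e, norm_eq_mul_conj, pow_succ, mul_comm z (star z), ← sub_mul]
    exact hfrob.mul_right _

/-- The square of an element of `ℤ√d` is an integer modulo `2`. -/
theorem exists_two_dvd_sq_sub_intCast (z : ℤ√d) : ∃ x : ℤ, (2 : ℤ√d) ∣ z ^ 2 - x := by
  refine ⟨z.re ^ 2 + d * z.im ^ 2, z.re * z.im * (sqrtd : ℤ√d), ?_⟩
  ext
  · simp [sq]; ring
  · simp [sq]; ring

/-- The power `ξ ^ φ_D(r)` is an integer modulo `r`. -/
theorem dvd_im_pow_phi {D : ℤ} {r : ℕ} (hr : r ≠ 0) {ξ : ℤ√d} (hξ : IsCoprime ξ.norm (r : ℤ))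
    (h2 : kroneckerPrime D 2 = 0)
    (hD : ∀ p : ℕ, p.Prime → p ∣ r → p ≠ 2 → kroneckerPrime D p = jacobiSym d p) :
    (r : ℤ) ∣ (ξ ^ phi D r).im := by
  have key : ∀ p ∈ r.primeFactors, ((p ^ r.factorization p : ℕ) : ℤ) ∣ (ξ ^ phi D r).im := by
    intro p hp
    have hpp := Nat.prime_of_mem_primeFactors hp
    have hpr := Nat.dvd_of_mem_primeFactors hp
    have : Fact p.Prime := ⟨hpp⟩
    obtain ⟨x, hx⟩ : ∃ x : ℤ, (p : ℤ√d) ∣ ξ ^ ((p : ℤ) - kroneckerPrime D p).toNat - x := by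
      by_cases hp2 : p = 2
      · subst hp2
        rw [h2]
        exact_mod_cast exists_two_dvd_sq_sub_intCast ξ
      · rw [hD p hpp hpr hp2, ← jacobiSym.legendreSym.to_jacobiSym]
        exact exists_dvd_pow_sub_intCast hp2 ξ
          (hξ.of_isCoprime_of_dvd_right (Int.natCast_dvd_natCast.2 hpr))
    -- Raising a congruence modulo `p` to the power `p ^ (e - 1)` makes it hold modulo `p ^ e`; this
    -- supplies the factor `p ^ (e - 1)` of `phi`.
    have hlift := dvd_sub_pow_of_dvd_sub hx (r.factorization p - 1)
    have hpos : r.factorization p - 1 + 1 = r.factorization p :=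
      Nat.sub_add_cancel (hpp.factorization_pos_of_dvd hr hpr)
    rw [hpos, ← pow_mul, mul_comm] at hlift
    obtain ⟨q, hq⟩ := Finset.dvd_prod_of_mem
      (fun p => p ^ (r.factorization p - 1) * ((p : ℤ) - kroneckerPrime D p).toNat) hp
    have hphi : phi D r = _ := hq
    have h := hlift.trans (sub_dvd_pow_sub_pow _ _ q)
    rw [← pow_mul, ← hphi] at h
    have hcast : ((p : ℤ√d) ^ r.factorization p) =
        (((p ^ r.factorization p : ℕ) : ℤ) : ℤ√d) := by push_cast; rfl
    have hint : (((x : ℤ√d) ^ p ^ (r.factorization p - 1)) ^ q).im = 0 := by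
      rw [← Int.cast_pow, ← Int.cast_pow, im_intCast]
    rw [hcast, intCast_dvd] at h
    simpa [hint] using h.2
  rw [Int.natCast_dvd]
  conv_lhs => rw [← Nat.prod_factorization_pow_eq_self hr]
  refine Finset.prod_dvd_of_isRelPrime ?_ fun p hp => Int.natCast_dvd.1 (key p hp)
  intro p hp q hq hpq
  exact Nat.coprime_iff_isRelPrime.1 (Nat.coprime_pow_primes _ _ (Nat.prime_of_mem_primeFactors hp)
    (Nat.prime_of_mem_primeFactors hq) hpq)

end Zsqrtd

/-! ### Passage to classes and the main theorem. -/

open Zsqrtd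

/-- Being a norm form is a property of the class. -/
theorem isNormFormMod_of_mk_eq {D d N r : ℤ} {ξ : ℤ√d} {f g : PForm D}
    (hg : IsNormFormMod d N r ξ g.1) (h : FormClass.mk f = FormClass.mk g) :
    IsNormFormMod d N r ξ f.1 := by
  obtain ⟨A, hA⟩ : f ≈ g := Quotient.exact h
  rw [hA]
  exact hg.transform A

theorem FormClass.exists_isNormFormMod_pow {d N r : ℤ} {ξ : ℤ√d} {m : ℕ+}
    (hm : (m : ℤ) = -d * N ^ 2) (hr : r ∣ N) (F : FormClass (-4 * (m : ℤ)))
    (hF : ∃ f, FormClass.mk f = F ∧ IsNormFormMod d N r ξ f.1) (k : ℕ) :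
    ∃ f, FormClass.mk f = F.pow k ∧ IsNormFormMod d N r (ξ ^ k) f.1 := by
  induction k with
  | zero =>
    obtain ⟨q, rfl⟩ := hr
    -- The identity is the norm form of `1, N√d`; as `r ∣ N`, this lattice lies in `ℤ + rℤ√d`.
    refine ⟨_, rfl, 1, ⟨1, 0, by simp⟩, ((r * q : ℤ) : ℤ√d) * sqrtd,
      ⟨0, q * (sqrtd : ℤ√d), by push_cast; ring⟩, by simp, ?_⟩
    ext <;> simp [normForm, norm_def, hm]
    ring
  | succ k ih =>
    obtain ⟨f, hf, hfn⟩ := ih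
    obtain ⟨g, hg, hgn⟩ := hF
    obtain ⟨f', g', k', hf', hg', hk', hc⟩ := FormClass.mul_isComposition (F.pow k) F
    rw [pow_succ]
    exact ⟨k', hk', (isNormFormMod_of_mk_eq hfn (hf'.trans hf.symm)).composition
      (isNormFormMod_of_mk_eq hgn (hg'.trans hg.symm)) hc⟩

/-- The classes derived from the identity of `C(-4m)` are those of the norm forms of lattices in
`ℤ√(-m)`. -/
theorem FormClass.isDerived_e_iff {D N : ℤ} {m : ℕ+} {F : FormClass D} :
    F.IsDerived N (FormClass.e m) ↔
      ∃ (f : PForm D) (α β : ℤ√(-(m : ℤ))), FormClass.mk f = F ∧ (star α * β).im = N ∧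
        f.1 = normForm α β := by
  have he : (⟨1, 0, m⟩ : BQF) = normForm 1 (sqrtd : ℤ√(-(m : ℤ))) := by
    ext <;> simp [normForm, norm_def]
  constructor
  · rintro ⟨f, g, A, hf, hg, hA, hfg⟩
    obtain ⟨B, hB⟩ : g ≈ _ := Quotient.exact hg
    have hg' : g.1 = (normForm 1 (sqrtd : ℤ√(-(m : ℤ)))).transform B.1 := by
      rw [← he]; exact hB
    have hfn := hfg
    rw [hg', ← BQF.transform_mul, normForm_transform] at hfn
    refine ⟨f, _, _, hf, ?_, hfn⟩
    rw [im_star_mul_transform, Matrix.det_mul, B.2, hA]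
    simp
  · rintro ⟨f, α, β, hf, hN, hfn⟩
    refine ⟨f, _, !![α.re, β.re; α.im, β.im], hf, rfl, ?_, ?_⟩
    · rw [Matrix.det_fin_two_of, ← hN]
      simp; ring
    · change f.1 = (⟨1, 0, m⟩ : BQF).transform _
      rw [he, normForm_transform, hfn]
      congr 1 <;> ext <;> simp

theorem mainTheorem4 (a b n r : ℕ+) (hn : n = a ^ 2 * b) (hr : Nat.Coprime (r : ℕ) (a : ℕ))
    (g : FormClass (-4 * (n : ℤ))) (hg : g.IsDerived (a : ℤ) (FormClass.e b))
    (h : FormClass (-4 * ((n * r ^ 2 : ℕ+) : ℤ))) (hh : h.IsDerived (r : ℤ) g) :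
    (h.pow (phi (-4 * (n : ℤ)) (r : ℕ))).IsDerived ((a * r : ℕ+) : ℤ) (FormClass.e b) ∧
      (h.pow (phi (-4 * (n : ℤ)) (r : ℕ))).IsDerived (a : ℤ) (FormClass.e (b * r ^ 2)) := by
  obtain ⟨f₀, α₀, β₀, hf₀, hN₀, hfn₀⟩ := FormClass.isDerived_e_iff.1 hg
  obtain ⟨f₁, g₁, A, hf₁, hg₁, hA, hfg⟩ := hh
  obtain ⟨B, hB⟩ : g₁ ≈ f₀ := Quotient.exact (hg₁.trans hf₀.symm)
  -- A change of basis makes a value prime to `r` the leading coefficient, that is, the norm of the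
  -- first lattice vector.
  obtain ⟨x, y, ⟨u, v, huv⟩, hcop⟩ := f₁.2.2.1.exists_coprime (r : ℤ) (by simp)
  let S : Matrix.SpecialLinearGroup (Fin 2) ℤ :=
    ⟨!![x, -v; y, u], by rw [Matrix.det_fin_two_of]; linear_combination huv⟩
  let f : PForm (-4 * ((n * r ^ 2 : ℕ+) : ℤ)) := ⟨f₁.1.transform S.1, by
    rw [BQF.disc_transform, S.2, f₁.2.1]; ring, f₁.2.2.1.transform S, f₁.2.2.2.transform S⟩
  have hf : FormClass.mk f = h := by
    rw [← hf₁]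
    exact Quotient.sound ⟨S, rfl⟩
  obtain ⟨α, β, hN, hfn⟩ : ∃ α β : ℤ√(-(b : ℤ)), (star α * β).im = a * r ∧
      f.1 = normForm α β := by
    have hfn : f.1 = f₁.1.transform S.1 := rfl
    rw [hfg, hB, hfn₀, ← BQF.transform_mul, ← BQF.transform_mul, normForm_transform] at hfn
    refine ⟨_, _, ?_, hfn⟩
    rw [im_star_mul_transform, Matrix.det_mul, Matrix.det_mul, B.2, S.2, hA, hN₀]
    ring
  have hα : IsCoprime α.norm (r : ℤ) := by
    have : α.norm = f₁.1.eval x y := (congrArg BQF.a hfn).symm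
    rwa [this]
  have hmod := IsNormFormMod.of_isCoprime hN (dvd_mul_left _ _) hα
  rw [← hfn] at hmod
  obtain ⟨l, hl, γ, hγ, δ, hδ, hlN, hln⟩ :=
    FormClass.exists_isNormFormMod_pow (m := n * r ^ 2) (by rw [hn]; push_cast; ring)
      (dvd_mul_left _ _) h ⟨f, hf, hmod⟩ (phi (-4 * (n : ℤ)) r)
  have him : ((r : ℕ) : ℤ) ∣ (α ^ phi (-4 * (n : ℤ)) r).im := by
    refine dvd_im_pow_phi r.ne_zero hα ?_ ?_
    · have h8 : ∀ x : ZMod 8, ZMod.χ₈ (-4 * x) = 0 := by decide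
      simp only [kroneckerPrime, if_true]
      push_cast
      exact h8 _
    · intro p hp hpr hp2
      -- The square `(2a)²` is prime to `p` because `p` is odd and `gcd(r, a) = 1`, so only `(-b/p)`
      -- remains.
      have hD : -4 * (n : ℤ) = (2 * a) ^ 2 * -(b : ℤ) := by rw [hn]; push_cast; ring
      rw [kroneckerPrime, if_neg hp2, hD, jacobiSym.mul_left, jacobiSym.sq_one', one_mul]
      have h2 : Nat.Coprime 2 p := (Nat.coprime_primes Nat.prime_two hp).2 (Ne.symm hp2)
      have ha : Nat.Coprime a p := (hr.coprime_dvd_left hpr).symm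
      exact_mod_cast h2.mul_left ha
  refine ⟨FormClass.isDerived_e_iff.2 ⟨l, γ, δ, hl, by rw [hlN]; push_cast; rfl, hln⟩,
    FormClass.isDerived_e_iff.2 ?_⟩
  obtain ⟨s, hs⟩ := dvd_im_of_mem_multiplesMod him hγ
  obtain ⟨t, ht⟩ := dvd_im_of_mem_multiplesMod him hδ
  -- Rewriting `r√(-b)` as `√(-br²)` divides the imaginary parts by `r`: norms are unchanged and the
  -- index `ar` becomes `a`.
  refine ⟨l, ⟨γ.re, s⟩, ⟨δ.re, t⟩, hl, ?_, ?_⟩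
  · have hr0 : (r : ℤ) ≠ 0 := by simp
    refine mul_right_cancel₀ hr0 (Eq.trans ?_ hlN)
    rw [im_star_mul, im_star_mul, hs, ht]; ring
  · rw [hln]
    ext <;> simp only [normForm, norm_def, re_star_mul, hs, ht] <;> push_cast <;> ring
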